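/- Let $(\Omega,P)$ be a probability space carrying an outcome $Y$ (real-valued), a treatment $A$, covariates $X$, a negative control outcome $W$, an unmeasured confounder $U$ ($W$ and $U$ with values in standard Borel spaces) and a tie indicator $S\in\{0,1\}$ with $P(S=1)>0$. All laws below are conditional on $S=1$. Fix a regular conditional law of $(Y,W,U)$ given $(A,X)=(a,x)$; write $F(w\mid a,x)$, $F(u\mid a,x)$, $F(w,u\mid a,x)$ for its marginals, and compute the conditional expectations $E(\cdot\mid a,u,x)$ and $E(\cdot\mid w,a,x)$ under it. Let $T$ be a set of values $(a,x)$ (for instance, all $(a,x)$ with $a$ in the support of $A$). Assume that for every $(a,x)\in T$: 1. (Completeness of $W$ for $U$) if $f\in L^2\{F(u\mid a,x)\}$ and $E\{f(U)\mid W=w,A=a,X=x\}=0$ for $F(w\mid a,x)$-almost all $w$, then $f=0$ $F(u\mid a,x)$-almost everywhere. 2. (Regularity) (a) $F(w,u\mid a,x)$ is absolutely continuous with respect to $F(w\mid a,x)\otimes F(u\mid a,x)$, and its density $K(w,u,a,x)=\dfrac{dF(w,u\mid a,x)}{dF(w\mid a,x)\,dF(u\mid a,x)}$ satisfies $\iint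 K(w,u,a,x)^2\,dF(w\mid a,x)\,dF(u\mid a,x)<\infty$; (b) $E(Y\mid a,u,x)$ exists for $F(u\mid a,x)$-almost all $u$ and $\int E(Y\mid a,u,x)^2\,dF(u\mid a,x)<\infty$; (c) $\displaystyle\sum_{p}\frac{1}{\nu_{a,x,p}^2}\bigl|\langle E(Y\mid a,\cdot,x),\kappa_{a,x,p}\rangle\bigr|^2<\infty$ (inner product of $L^2\{F(u\mid a,x)\}$), where $(\nu_{a,x,p},\upsilon_{a,x,p},\kappa_{a,x,p})_p$ is a (finite or infinite) singular system, with $\nu_{a,x,p}>0$, of the operator $K_{a,x}:L^2\{F(w\mid a,x)\}\to L^2\{F(u\mid a,x)\}$, $(K_{a,x}g)(u)=\int K(w,u,a,x)g(w)\,dF(w\mid a,x)$ (the value of the sum does not depend on the choice of the singular system). Then there is a measurable function $h(w,a,x)$ such that for every $(a,x)\in T$ we have $h(\cdot,a,x)\in L^2\{F(w\mid a,x)\}$ and $$E(Y\mid A=a,U=u,X=x,S=1)=E\{h(W,a,x)\mid A=a,U=u,X=x,S=1\}\quad\text{for } F(u\mid a,x)\text{-almost all }u .$$ -/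

import Mathlib

open MeasureTheory ProbabilityTheory
open scoped ENNReal

noncomputable section

namespace ConfoundingBridge

section IntegralOperator

variable {𝒲 𝒰 : Type*} [MeasurableSpace 𝒲] [MeasurableSpace 𝒰]
  {p : Measure 𝒲} {q : Measure 𝒰} [IsFiniteMeasure p] [IsFiniteMeasure q]

/-- The function `u ↦ ∫ k(w, u) h(w) dp(w)`. -/
def kernelIntegral (p : Measure 𝒲) (k : 𝒲 × 𝒰 → ℝ) (h : 𝒲 → ℝ) : 𝒰 → ℝ :=
  fun u => ∫ w, k (w, u) * h w ∂p

lemma eLpNorm_two_eq {α : Type*} [MeasurableSpace α] (μ : Measure α) (f : α → ℝ) :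
    eLpNorm f 2 μ = (∫⁻ x, ‖f x‖ₑ ^ (2 : ℝ) ∂μ) ^ (1 / (2 : ℝ)) := by
  rw [eLpNorm_eq_lintegral_rpow_enorm_toReal two_ne_zero ENNReal.ofNat_ne_top]
  simp

lemma eLpNorm_kernelIntegral_le {k : 𝒲 × 𝒰 → ℝ} (hk : AEStronglyMeasurable k (p.prod q))
    {h : 𝒲 → ℝ} (hh : AEStronglyMeasurable h p) :
    eLpNorm (kernelIntegral p k h) 2 q ≤ eLpNorm k 2 (p.prod q) * eLpNorm h 2 p := by
  have hconj : (2 : ℝ).HolderConjugate 2 := by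
    rw [Real.holderConjugate_iff]; norm_num
  have key : ∀ᵐ u ∂q, ‖kernelIntegral p k h u‖ₑ ^ (2 : ℝ) ≤
      (∫⁻ w, ‖k (w, u)‖ₑ ^ (2 : ℝ) ∂p) * ∫⁻ w, ‖h w‖ₑ ^ (2 : ℝ) ∂p := by
    filter_upwards [hk.prodMk_right] with u hu
    have h1 : ‖kernelIntegral p k h u‖ₑ ≤
        (∫⁻ w, ‖k (w, u)‖ₑ ^ (2 : ℝ) ∂p) ^ (1 / (2 : ℝ)) *
          (∫⁻ w, ‖h w‖ₑ ^ (2 : ℝ) ∂p) ^ (1 / (2 : ℝ)) := by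
      refine (enorm_integral_le_lintegral_enorm _).trans ?_
      simp_rw [enorm_mul]
      exact ENNReal.lintegral_mul_le_Lp_mul_Lq p hconj hu.enorm hh.enorm
    refine (ENNReal.rpow_le_rpow h1 (by norm_num : (0 : ℝ) ≤ 2)).trans ?_
    rw [ENNReal.mul_rpow_of_nonneg _ _ (by norm_num), ← ENNReal.rpow_mul, ← ENNReal.rpow_mul]
    norm_num
  rw [eLpNorm_two_eq, eLpNorm_two_eq, eLpNorm_two_eq, ← ENNReal.mul_rpow_of_nonneg _ _ (by norm_num)]
  refine ENNReal.rpow_le_rpow ?_ (by norm_num)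
  have hm : AEMeasurable (fun u => ∫⁻ w, ‖k (w, u)‖ₑ ^ (2 : ℝ) ∂p) q :=
    (hk.enorm.pow_const (2 : ℝ)).prod_swap.lintegral_prod_right'
  rw [lintegral_prod_symm _ (hk.enorm.pow_const _), ← lintegral_mul_const'' _ hm]
  exact lintegral_mono_ae key

lemma memLp_kernelIntegral {k : 𝒲 × 𝒰 → ℝ} (hk : MemLp k 2 (p.prod q))
    {h : 𝒲 → ℝ} (hh : MemLp h 2 p) : MemLp (kernelIntegral p k h) 2 q := by
  refine ⟨?_, (eLpNorm_kernelIntegral_le hk.1 hh.1).trans_lt (ENNReal.mul_lt_top hk.2 hh.2)⟩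
  exact (hk.1.mul hh.1.comp_fst).prod_swap.integral_prod_right'

lemma ae_integrable_kernel_mul {k : 𝒲 × 𝒰 → ℝ} (hk : MemLp k 2 (p.prod q))
    {h : 𝒲 → ℝ} (hh : MemLp h 2 p) : ∀ᵐ u ∂q, Integrable (fun w => k (w, u) * h w) p := by
  have h1 : MemLp (fun z : 𝒲 × 𝒰 => h z.1) 2 (p.prod q) := hh.comp_fst q
  exact (hk.integrable_mul h1).prod_left_ae

/-- The linear map underlying `integralOperator`. -/
def integralLinearMap (k : 𝒲 × 𝒰 → ℝ) (hk : MemLp k 2 (p.prod q)) : Lp ℝ 2 p →ₗ[ℝ] Lp ℝ 2 q where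
  toFun h := (memLp_kernelIntegral hk (Lp.memLp h)).toLp (kernelIntegral p k h)
  map_add' := by
    intro f g
    rw [← MemLp.toLp_add]
    refine MemLp.toLp_congr _ _ ?_
    filter_upwards [ae_integrable_kernel_mul hk (Lp.memLp f),
      ae_integrable_kernel_mul hk (Lp.memLp g)] with u hf hg
    simp only [kernelIntegral, Pi.add_apply]
    rw [← integral_add hf hg]
    refine integral_congr_ae ?_
    filter_upwards [Lp.coeFn_add f g] with w hw
    rw [hw, Pi.add_apply, mul_add]
  map_smul' := by
    intro c f
    rw [RingHom.id_apply, ← MemLp.toLp_const_smul]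
    refine MemLp.toLp_congr _ _ (Filter.Eventually.of_forall fun u => ?_)
    simp only [kernelIntegral, Pi.smul_apply, smul_eq_mul]
    rw [← integral_const_mul]
    refine integral_congr_ae ?_
    filter_upwards [Lp.coeFn_smul c f] with w hw
    rw [hw, Pi.smul_apply, smul_eq_mul]
    ring

lemma norm_integralLinearMap_le (k : 𝒲 × 𝒰 → ℝ) (hk : MemLp k 2 (p.prod q)) (f : Lp ℝ 2 p) :
    ‖integralLinearMap k hk f‖ ≤ (eLpNorm k 2 (p.prod q)).toReal * ‖f‖ := by
  have h1 : ‖integralLinearMap k hk f‖ = (eLpNorm (kernelIntegral p k f) 2 q).toReal :=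
    Lp.norm_toLp _ (memLp_kernelIntegral hk (Lp.memLp f))
  rw [h1, Lp.norm_def, ← ENNReal.toReal_mul]
  exact ENNReal.toReal_mono (ENNReal.mul_lt_top hk.2 (Lp.memLp f).2).ne
    (eLpNorm_kernelIntegral_le hk.1 (Lp.memLp f).1)

/-- The integral operator `h ↦ ∫ k(w, ·) h(w) dp(w)` from `L²(p)` to `L²(q)` given by a kernel `k`
that is square integrable for `p ⊗ q`. -/
def integralOperator (k : 𝒲 × 𝒰 → ℝ) (hk : MemLp k 2 (p.prod q)) : Lp ℝ 2 p →L[ℝ] Lp ℝ 2 q :=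
  (integralLinearMap k hk).mkContinuous (eLpNorm k 2 (p.prod q)).toReal
    (norm_integralLinearMap_le k hk)

end IntegralOperator

/-- `(ν, υ, κ)` is a singular system of the operator `K`: positive singular values `ν i` and
orthonormal families `υ`, `κ` with `K υᵢ = νᵢ κᵢ`, `K* κᵢ = νᵢ υᵢ` and
`K h = ∑ᵢ νᵢ ⟨υᵢ, h⟩ κᵢ` for every `h`. The index set may be finite (operators of finite rank). -/
structure IsSingularSystem {E F : Type*} [NormedAddCommGroup E] [InnerProductSpace ℝ E]
    [CompleteSpace E] [NormedAddCommGroup F] [InnerProductSpace ℝ F] [CompleteSpace F]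
    (K : E →L[ℝ] F) {ι : Type} (ν : ι → ℝ) (υ : ι → E) (κ : ι → F) : Prop where
  pos : ∀ i, 0 < ν i
  orthonormal_left : Orthonormal ℝ υ
  orthonormal_right : Orthonormal ℝ κ
  map_left : ∀ i, K (υ i) = ν i • κ i
  map_right : ∀ i, K.adjoint (κ i) = ν i • υ i
  expansion : ∀ h : E, HasSum (fun i => (ν i * inner ℝ (υ i) h) • κ i) (K h)

section Fibre

/-! Below, `Q` is a probability measure on `ℝ × 𝒲 × 𝒰`: the conditional law of `(Y, W, U)` given
`A = a` and `X = x`. -/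

variable {𝒲 𝒰 : Type*} [MeasurableSpace 𝒲] [MeasurableSpace 𝒰]

/-- `F(w | a, x)`. -/
def lawW (Q : Measure (ℝ × 𝒲 × 𝒰)) : Measure 𝒲 := Q.map (fun z => z.2.1)

/-- `F(u | a, x)`. -/
def lawU (Q : Measure (ℝ × 𝒲 × 𝒰)) : Measure 𝒰 := Q.map (fun z => z.2.2)

/-- `F(w, u | a, x)`. -/
def lawWU (Q : Measure (ℝ × 𝒲 × 𝒰)) : Measure (𝒲 × 𝒰) := Q.map (fun z => z.2)

instance (Q : Measure (ℝ × 𝒲 × 𝒰)) [IsFiniteMeasure Q] : IsFiniteMeasure (lawW Q) := by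
  unfold lawW; infer_instance

instance (Q : Measure (ℝ × 𝒲 × 𝒰)) [IsFiniteMeasure Q] : IsFiniteMeasure (lawU Q) := by
  unfold lawU; infer_instance

instance (Q : Measure (ℝ × 𝒲 × 𝒰)) [IsFiniteMeasure Q] : IsFiniteMeasure (lawWU Q) := by
  unfold lawWU; infer_instance

/-- The conditional law of `Y` given `A = a, U = u, X = x`. -/
def lawYGivenU (Q : Measure (ℝ × 𝒲 × 𝒰)) [IsFiniteMeasure Q] : Kernel 𝒰 ℝ :=
  condDistrib (fun z => z.1) (fun z => z.2.2) Q

/-- The conditional law of `W` given `A = a, U = u, X = x`. -/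
def lawWGivenU [StandardBorelSpace 𝒲] [Nonempty 𝒲] (Q : Measure (ℝ × 𝒲 × 𝒰))
    [IsFiniteMeasure Q] : Kernel 𝒰 𝒲 :=
  condDistrib (fun z => z.2.1) (fun z => z.2.2) Q

/-- The conditional law of `U` given `W = w, A = a, X = x`. -/
def lawUGivenW [StandardBorelSpace 𝒰] [Nonempty 𝒰] (Q : Measure (ℝ × 𝒲 × 𝒰))
    [IsFiniteMeasure Q] : Kernel 𝒲 𝒰 :=
  condDistrib (fun z => z.2.2) (fun z => z.2.1) Q

/-- `u ↦ E(Y | a, u, x)`. -/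
def outcomeMean (Q : Measure (ℝ × 𝒲 × 𝒰)) [IsFiniteMeasure Q] : 𝒰 → ℝ :=
  fun u => ∫ y, y ∂(lawYGivenU Q u)

/-- `K(w, u, a, x) = dF(w, u | a, x) / (dF(w | a, x) dF(u | a, x))`. -/
def densityRatio (Q : Measure (ℝ × 𝒲 × 𝒰)) : 𝒲 × 𝒰 → ℝ :=
  fun z => ((lawWU Q).rnDeriv ((lawW Q).prod (lawU Q)) z).toReal

/-- Completeness of `W` for `U` given `A = a, X = x`: a square integrable `f` with
`E{f(U) | W = w, a, x} = 0` for almost all `w` vanishes almost surely. -/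
def Complete [StandardBorelSpace 𝒰] [Nonempty 𝒰] (Q : Measure (ℝ × 𝒲 × 𝒰))
    [IsFiniteMeasure Q] : Prop :=
  ∀ f : 𝒰 → ℝ, MemLp f 2 (lawU Q) →
    (∀ᵐ w ∂(lawW Q), ∫ u, f u ∂(lawUGivenW Q w) = 0) → f =ᵐ[lawU Q] 0

/-- The regularity conditions at `(a, x)`. -/
structure Regular (Q : Measure (ℝ × 𝒲 × 𝒰)) [IsFiniteMeasure Q] : Prop where
  /-- the density ratio exists -/
  abs_cont : lawWU Q ≪ (lawW Q).prod (lawU Q)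
  /-- and is square integrable, `∬ K(w, u, a, x)² dF(w | a, x) dF(u | a, x) < ∞` -/
  ratio_memLp : MemLp (densityRatio Q) 2 ((lawW Q).prod (lawU Q))
  /-- `E(Y | a, u, x)` exists -/
  outcome_integrable : ∀ᵐ u ∂(lawU Q), Integrable (fun y : ℝ => y) (lawYGivenU Q u)
  /-- and is square integrable -/
  outcome_memLp : MemLp (outcomeMean Q) 2 (lawU Q)
  /-- Picard's condition for the operator `K_{a,x}` with kernel `K(w, u, a, x)`. The value of the
  sum is the same for all singular systems of an operator. -/
  picard : ∀ (ι : Type) [Countable ι] (ν : ι → ℝ) (υ : ι → Lp ℝ 2 (lawW Q))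
    (κ : ι → Lp ℝ 2 (lawU Q)),
    IsSingularSystem (integralOperator (densityRatio Q) ratio_memLp) ν υ κ →
      Summable fun i => 1 / ν i ^ 2 * |inner ℝ (outcome_memLp.toLp (outcomeMean Q)) (κ i)| ^ 2

/-- `g = h(·, a, x)` is a square integrable solution of
`E(Y | A = a, U = u, X = x) = E{g(W) | A = a, U = u, X = x}` for almost all `u`. -/
structure SolvesBridgeEquation [StandardBorelSpace 𝒲] [Nonempty 𝒲]
    (Q : Measure (ℝ × 𝒲 × 𝒰)) [IsFiniteMeasure Q] (g : 𝒲 → ℝ) : Prop where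
  memLp : MemLp g 2 (lawW Q)
  integrable : ∀ᵐ u ∂(lawU Q), Integrable g (lawWGivenU Q u)
  equation : ∀ᵐ u ∂(lawU Q), outcomeMean Q u = ∫ w, g w ∂(lawWGivenU Q u)

end Fibre

end ConfoundingBridge

end

/-!
For a fixed `(a, x)` the bridge equation reads `K g = m` with `K = K_{a,x}` and
`m = E(Y | a, ·, x)`, and Picard's criterion solves it: completeness says that `K*` is injective, so
the `κᵢ` of a singular system form an orthonormal basis and `∑ᵢ νᵢ⁻¹ ⟨m, κᵢ⟩ υᵢ` is a solution.

Such solutions need not be jointly measurable in `(w, a, x)`, so they only serve to show that the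
equation is solvable. `K` and `K*` are conditional expectations, given by kernels that depend
measurably on `(a, x)`, hence so do the Landweber iterates `g ↦ g + K*(m - K g)`. Conditional
expectations are contractions, so `1 - K*K` is a contraction and von Neumann's mean ergodic theorem
makes the averages of the iterates converge in `L²` to a solution. A version of this limit is
jointly measurable: along every fibre it is an almost everywhere limit of averages whose indices can
be chosen measurably in `(a, x)`.
-/

namespace ConfoundingBridge

open Filter Set Submodule
open scoped Topology

section Hilbert

variable {𝕜 E F ι : Type*} [RCLike 𝕜] [NormedAddCommGroup E] [InnerProductSpace 𝕜 E]
  [NormedAddCommGroup F] [InnerProductSpace 𝕜 F]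

lemma inner_eq_of_hasSum_smul_of_orthonormal {v : ι → E} (hv : Orthonormal 𝕜 v) {c : ι → 𝕜}
    {x : E} (hx : HasSum (fun j => c j • v j) x) (i : ι) : inner 𝕜 (v i) x = c i := by
  have hsum := hx.mapL (innerSL 𝕜 (v i))
  have hzero (j : ι) (hj : j ≠ i) : innerSL 𝕜 (v i) (c j • v j) = 0 := by simp [hv.2 hj.symm]
  simpa [hv.1 i] using hsum.unique (hasSum_single i hzero)

lemma norm_sub_eq_sqrt_two_of_orthonormal {v : ι → E} (hv : Orthonormal 𝕜 v) {i j : ι}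
    (hij : i ≠ j) : ‖v i - v j‖ = √2 := by
  have h : ‖v i - v j‖ ^ 2 = 2 := by
    rw [norm_sub_sq (𝕜 := 𝕜), hv.1 i, hv.1 j, hv.2 hij]
    norm_num
  rw [← h, Real.sqrt_sq (norm_nonneg _)]

lemma countable_of_orthonormal [TopologicalSpace.SeparableSpace E] {v : ι → E}
    (hv : Orthonormal 𝕜 v) : Countable ι := by
  have hdisj : Pairwise (Function.onFun Disjoint fun i => Metric.ball (v i) (√2 / 2)) :=
    fun i j hij => Metric.ball_disjoint_ball (by
      rw [add_halves, dist_eq_norm, norm_sub_eq_sqrt_two_of_orthonormal hv hij])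
  exact hdisj.countable_of_isOpen_disjoint (fun _ => Metric.isOpen_ball)
    fun i => Metric.nonempty_ball.mpr (by positivity)

lemma orthogonal_span_sigma_le_orthogonal_iSup {κ : ι → Type*} {V : ι → Submodule 𝕜 E}
    (b : ∀ i, HilbertBasis (κ i) 𝕜 (V i)) :
    (span 𝕜 (range fun j : Σ i, κ i => (b j.1 j.2 : E)))ᗮ ≤ (⨆ i, V i)ᗮ := by
  intro x hx
  rw [← iInf_orthogonal, Submodule.mem_iInf]
  intro i
  have hzero : innerSL 𝕜 x ∘L (V i).subtypeL = 0 := by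
    refine ContinuousLinearMap.ext_on
      ((dense_iff_topologicalClosure_eq_top).mpr (b i).dense_span) ?_
    rintro _ ⟨j, rfl⟩
    exact inner_left_of_mem_orthogonal (subset_span (mem_range_self (⟨i, j⟩ : Σ i, κ i))) hx
  exact fun v hv => inner_eq_zero_symm.mp (DFunLike.congr_fun hzero ⟨v, hv⟩)

lemma isClosed_eigenspace (T : E →L[𝕜] E) (μ : 𝕜) :
    IsClosed (Module.End.eigenspace (T : Module.End 𝕜 E) μ : Set E) := by
  convert isClosed_eq T.continuous (continuous_const_smul μ) using 1
  ext x
  simp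

lemma exists_hilbertBasis_eigenvectors [CompleteSpace E] [TopologicalSpace.SeparableSpace E]
    {T : E →L[𝕜] E} (hT : IsCompactOperator T) (hsymm : (T : E →ₗ[𝕜] E).IsSymmetric) :
    ∃ (ι : Type) (_ : Countable ι) (b : HilbertBasis ι 𝕜 E) (μ : ι → 𝕜),
      ∀ i, T (b i) = μ i • b i := by
  have (μ : 𝕜) : CompleteSpace (Module.End.eigenspace (T : Module.End 𝕜 E) μ) :=
    (isClosed_eigenspace T μ).completeSpace_coe
  choose κ b _ using fun μ : 𝕜 =>
    exists_hilbertBasis 𝕜 (Module.End.eigenspace (T : Module.End 𝕜 E) μ)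
  have hon : Orthonormal 𝕜 fun i : Σ μ, κ μ => (b i.1 i.2 : E) :=
    hsymm.orthogonalFamily_eigenspaces.orthonormal_sigma_orthonormal fun μ => (b μ).orthonormal
  have hbot : (span 𝕜 (range fun i : Σ μ, κ μ => (b i.1 i.2 : E)))ᗮ = ⊥ :=
    eq_bot_mono (orthogonal_span_sigma_le_orthogonal_iSup b)
      (ContinuousLinearMap.orthogonalComplement_iSup_eigenspaces_eq_bot hT hsymm)
  have : Countable (Σ μ, κ μ) := countable_of_orthonormal hon
  let e : Shrink.{0} (Σ μ, κ μ) ≃ Σ μ, κ μ := (equivShrink _).symm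
  refine ⟨_, e.countable_iff.mpr this, .mkOfOrthogonalEqBot (hon.comp e e.injective) ?_,
    fun i => (e i).1, fun i => ?_⟩
  · rwa [e.surjective.range_comp]
  · rw [HilbertBasis.coe_mkOfOrthogonalEqBot]
    exact Module.End.mem_eigenspace_iff.mp (b (e i).1 (e i).2).2

lemma norm_sum_innerSL_smulRight_le {v : ι → E} (hv : Orthonormal 𝕜 v) (y : ι → F)
    (s : Finset ι) :
    ‖∑ i ∈ s, (innerSL 𝕜 (v i)).smulRight (y i)‖ ≤ √(∑ i ∈ s, ‖y i‖ ^ 2) := by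
  refine ContinuousLinearMap.opNorm_le_bound _ (Real.sqrt_nonneg _) fun x => ?_
  calc ‖(∑ i ∈ s, (innerSL 𝕜 (v i)).smulRight (y i)) x‖
      = ‖∑ i ∈ s, inner 𝕜 (v i) x • y i‖ := by simp
    _ ≤ ∑ i ∈ s, ‖y i‖ * ‖inner 𝕜 (v i) x‖ :=
        norm_sum_le_of_le _ fun i _ => by rw [norm_smul, mul_comm]
    _ ≤ √(∑ i ∈ s, ‖y i‖ ^ 2) * √(∑ i ∈ s, ‖inner 𝕜 (v i) x‖ ^ 2) :=
        Real.sum_mul_le_sqrt_mul_sqrt _ _ _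
    _ ≤ √(∑ i ∈ s, ‖y i‖ ^ 2) * ‖x‖ := by
        gcongr
        exact (Real.sqrt_le_left (norm_nonneg x)).mpr (hv.sum_inner_products_le x)

-- A Hilbert–Schmidt operator is the sum, in operator norm, of the rank one operators
-- `x ↦ ⟪b i, x⟫ • K (b i)`.
theorem isCompactOperator_of_summable_norm_sq [CompleteSpace F] (b : HilbertBasis ι 𝕜 E)
    {K : E →L[𝕜] F} (hK : Summable fun i => ‖K (b i)‖ ^ 2) : IsCompactOperator K := by
  let R (i : ι) : E →L[𝕜] F := (innerSL 𝕜 (b i)).smulRight (K (b i))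
  have hR : Summable R := by
    rw [summable_iff_vanishing_norm]
    intro ε hε
    obtain ⟨s, hs⟩ := summable_iff_vanishing_norm.mp hK (ε ^ 2) (by positivity)
    refine ⟨s, fun t hts => (norm_sum_innerSL_smulRight_le b.orthonormal _ t).trans_lt ?_⟩
    rw [Real.sqrt_lt' hε]
    exact (le_abs_self _).trans_lt (hs t hts)
  have hsum : HasSum R K := by
    convert hR.hasSum
    ext x
    have hx := (b.hasSum_repr x).mapL K
    simp only [map_smul, b.repr_apply_apply] at hx
    exact hx.unique (hR.hasSum.mapL (ContinuousLinearMap.apply 𝕜 F x))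
  refine isCompactOperator_of_tendsto hsum (Eventually.of_forall fun s => ?_)
  refine Finset.sum_induction R (fun T : E →L[𝕜] F => IsCompactOperator T)
    (fun _ _ hS hT => hS.add hT) isCompactOperator_zero fun i _ => ?_
  exact (isCompactOperator_of_locallyCompactSpace_dom (innerSL 𝕜 (b i))).clm_comp
    (ContinuousLinearMap.toSpanSingleton 𝕜 (K (b i)))

lemma norm_one_sub_adjoint_comp_self_le_one [CompleteSpace E] [CompleteSpace F] {K : E →L[𝕜] F}
    (hK : ‖K‖ ≤ 1) : ‖1 - K.adjoint ∘L K‖ ≤ 1 := by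
  refine ContinuousLinearMap.opNorm_le_bound _ zero_le_one fun x => ?_
  rw [one_mul]
  have hadj : ‖K.adjoint (K x)‖ ≤ ‖K x‖ := by
    simpa using K.adjoint.le_of_opNorm_le ((LinearIsometryEquiv.norm_map _ K).le.trans hK) (K x)
  refine le_of_sq_le_sq ?_ (norm_nonneg x)
  calc ‖x - K.adjoint (K x)‖ ^ 2
      = ‖x‖ ^ 2 - 2 * ‖K x‖ ^ 2 + ‖K.adjoint (K x)‖ ^ 2 := by
        rw [norm_sub_sq (𝕜 := 𝕜), ContinuousLinearMap.adjoint_inner_right,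
          inner_self_eq_norm_sq_to_K]
        norm_cast
    _ ≤ ‖x‖ ^ 2 := by nlinarith [norm_nonneg (K.adjoint (K x)), norm_nonneg (K x)]

theorem exists_tendsto_average_landweber [CompleteSpace E] [CompleteSpace F] {K : E →L[𝕜] F}
    (hK : ‖K‖ ≤ 1) {y : F} (hy : y ∈ K.range) {x : ℕ → E}
    (hx : ∀ n, x (n + 1) = x n + K.adjoint (y - K (x n))) :
    ∃ z, K z = y ∧
      Tendsto (fun N : ℕ => (N : 𝕜)⁻¹ • ∑ n ∈ Finset.range N, x n) atTop (𝓝 z) := by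
  obtain ⟨x', rfl⟩ := hy
  let R : E →L[𝕜] E := 1 - K.adjoint ∘L K
  have hiter (n : ℕ) : x n = x' + R^[n] (x 0 - x') := by
    induction n with
    | zero => simp
    | succ n ih =>
      rw [Function.iterate_succ_apply', ← sub_eq_iff_eq_add'.mpr ih, hx]
      simp only [R, sub_apply, one_apply_eq_self, ContinuousLinearMap.comp_apply,
        map_sub, ContinuousLinearMap.coe_coe]
      abel
  let z := (R.eqLocus (1 : E →L[𝕜] E)).orthogonalProjectionOnto (x 0 - x')
  have hz : K z = 0 := by
    have hfix : (z : E) - K.adjoint (K z) = z := z.2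
    rw [← inner_self_eq_zero (𝕜 := 𝕜), ← ContinuousLinearMap.adjoint_inner_right,
      sub_eq_self.mp hfix, inner_zero_right]
  refine ⟨x' + z, by rw [map_add, hz, add_zero]; rfl, ?_⟩
  refine (tendsto_const_nhds.add (R.tendsto_birkhoffAverage_orthogonalProjection
    (norm_one_sub_adjoint_comp_self_le_one hK) (x 0 - x'))).congr' ?_
  filter_upwards [eventually_ne_atTop 0] with N hN
  rw [Finset.sum_congr rfl fun n _ => hiter n, Finset.sum_add_distrib, smul_add, Finset.sum_const,
    Finset.card_range, ← Nat.cast_smul_eq_nsmul 𝕜, inv_smul_smul₀ (Nat.cast_ne_zero.mpr hN)]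
  rfl

end Hilbert

section SingularSystem

variable {E F : Type*} [NormedAddCommGroup E] [InnerProductSpace ℝ E] [CompleteSpace E]
  [NormedAddCommGroup F] [InnerProductSpace ℝ F] [CompleteSpace F] {K : E →L[ℝ] F} {ι : Type}

lemma isSingularSystem_of_eigenbasis (b : HilbertBasis ι ℝ E) {μ : ι → ℝ}
    (hb : ∀ i, K.adjoint (K (b i)) = μ i • b i) :
    IsSingularSystem K (fun i : {i // K (b i) ≠ 0} => ‖K (b i)‖) (fun i => b i)
      (fun i => ‖K (b i)‖⁻¹ • K (b i)) := by
  have hinner (i j : ι) : inner ℝ (K (b i)) (K (b j)) = μ j * inner ℝ (b i) (b j) := by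
    rw [← ContinuousLinearMap.adjoint_inner_right, hb, inner_smul_right]
  have hμ (i : ι) : μ i = ‖K (b i)‖ ^ 2 := by
    simpa [b.orthonormal.1 i] using (hinner i i).symm
  have hne (i : {i // K (b i) ≠ 0}) : ‖K (b i)‖ ≠ 0 := norm_ne_zero_iff.mpr i.2
  refine ⟨fun i => norm_pos_iff.mpr i.2, b.orthonormal.comp _ Subtype.val_injective,
    ⟨fun i => ?_, fun i j hij => ?_⟩, fun i => ?_, fun i => ?_, fun x => ?_⟩
  · rw [norm_smul, norm_inv, norm_norm, inv_mul_cancel₀ (hne i)]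
  · dsimp only
    rw [real_inner_smul_left, real_inner_smul_right, hinner,
      b.orthonormal.2 (Subtype.val_injective.ne hij), mul_zero, mul_zero, mul_zero]
  · rw [smul_inv_smul₀ (hne i)]
  · rw [map_smul, hb, smul_smul, hμ, sq, inv_mul_cancel_left₀ (hne i)]
  · have hsum := (b.hasSum_repr x).mapL K
    simp only [map_smul, b.repr_apply_apply] at hsum
    have hzero (i : ι) (hi : i ∉ range ((↑) : {i // K (b i) ≠ 0} → ι)) :
        inner ℝ (b i) x • K (b i) = 0 := by
      have hKi : K (b i) = 0 := by_contra fun h => hi ⟨⟨i, h⟩, rfl⟩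
      rw [hKi, smul_zero]
    refine ((Subtype.val_injective.hasSum_iff hzero).mpr hsum).congr_fun fun i => ?_
    rw [smul_smul, mul_right_comm, mul_inv_cancel₀ (hne i), one_mul, Function.comp_apply]

theorem exists_isSingularSystem [TopologicalSpace.SeparableSpace E] (hK : IsCompactOperator K) :
    ∃ (ι : Type) (_ : Countable ι) (ν : ι → ℝ) (υ : ι → E) (κ : ι → F),
      IsSingularSystem K ν υ κ := by
  obtain ⟨ι, _, b, μ, hb⟩ := exists_hilbertBasis_eigenvectors (T := K.adjoint ∘L K)
    (hK.clm_comp K.adjoint) K.isPositive_adjoint_comp_self.isSymmetric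
  exact ⟨_, inferInstance, _, _, _, isSingularSystem_of_eigenbasis b hb⟩

namespace IsSingularSystem

variable {ν : ι → ℝ} {υ : ι → E} {κ : ι → F}

lemma adjoint_eq_zero_of_inner_eq_zero (h : IsSingularSystem K ν υ κ) {z : F}
    (hz : ∀ i, inner ℝ z (κ i) = 0) : K.adjoint z = 0 := by
  refine ext_inner_right ℝ fun x => ?_
  rw [ContinuousLinearMap.adjoint_inner_left, inner_zero_left]
  have hsum := (h.expansion x).mapL (innerSL ℝ z)
  simp only [innerSL_apply_apply, inner_smul_right, hz, mul_zero] at hsum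
  exact hsum.unique hasSum_zero

lemma summable_inv_mul_inner_smul (h : IsSingularSystem K ν υ κ) {y : F}
    (hy : Summable fun i => 1 / ν i ^ 2 * |inner ℝ y (κ i)| ^ 2) :
    Summable fun i => ((ν i)⁻¹ * inner ℝ y (κ i)) • υ i := by
  refine (h.orthonormal_left.orthogonalFamily.summable_iff_norm_sq_summable
    fun i => (ν i)⁻¹ * inner ℝ y (κ i)).mpr (hy.congr fun i => ?_)
  rw [norm_mul, mul_pow, norm_inv, inv_pow, Real.norm_eq_abs, Real.norm_eq_abs, sq_abs (ν i),
    one_div]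

theorem mem_range_of_summable (h : IsSingularSystem K ν υ κ) {y : F}
    (hyker : y ∈ K.adjoint.kerᗮ)
    (hy : Summable fun i => 1 / ν i ^ 2 * |inner ℝ y (κ i)| ^ 2) : y ∈ K.range := by
  have hsum := h.summable_inv_mul_inner_smul hy
  set x := ∑' i, ((ν i)⁻¹ * inner ℝ y (κ i)) • υ i
  have hKx : HasSum (fun i => inner ℝ y (κ i) • κ i) (K x) := by
    refine (hsum.hasSum.mapL K).congr_fun fun i => ?_
    rw [map_smul, h.map_left, smul_smul, mul_right_comm, inv_mul_cancel₀ (h.pos i).ne', one_mul]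
  have hker : y - K x ∈ K.adjoint.ker := by
    refine h.adjoint_eq_zero_of_inner_eq_zero fun i => ?_
    rw [inner_sub_left, real_inner_comm (κ i) (K x),
      inner_eq_of_hasSum_smul_of_orthonormal h.orthonormal_right hKx, sub_self]
  have hperp : y - K x ∈ K.adjoint.kerᗮ := by
    refine sub_mem hyker ?_
    rw [← K.orthogonal_range]
    exact K.range.le_orthogonal_orthogonal ⟨x, rfl⟩
  exact ⟨x, (sub_eq_zero.mp (disjoint_def.mp (orthogonal_disjoint _) _ hker hperp)).symm⟩

end IsSingularSystem

end SingularSystem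

section KernelOperator

variable {𝒲 𝒰 : Type*} [MeasurableSpace 𝒲] {p : Measure 𝒲} {k : 𝒲 × 𝒰 → ℝ}

lemma kernelIntegral_congr_ae {g g' : 𝒲 → ℝ} (h : g =ᵐ[p] g') :
    kernelIntegral p k g = kernelIntegral p k g' :=
  funext fun _ => integral_congr_ae (h.mono fun w hw => by dsimp only; rw [hw])

lemma norm_toLp_sq {f : 𝒲 → ℝ} (hf : MemLp f 2 p) : ‖hf.toLp f‖ ^ 2 = ∫ w, f w ^ 2 ∂p := by
  rw [← real_inner_self_eq_norm_sq, L2.inner_def]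
  refine integral_congr_ae (hf.coeFn_toLp.mono fun w hw => ?_)
  simp only [hw, Real.inner_apply, sq]

lemma inner_toLp_eq_kernelIntegral {u : 𝒰} (hu : MemLp (fun w => k (w, u)) 2 p) (g : Lp ℝ 2 p) :
    inner ℝ g (hu.toLp _) = kernelIntegral p k g u := by
  rw [L2.inner_def]
  refine integral_congr_ae (hu.coeFn_toLp.mono fun w hw => ?_)
  simp only [hw, Real.inner_apply, mul_comm]

lemma sum_kernelIntegral_sq_le {ι : Type*} {v : ι → Lp ℝ 2 p} (hv : Orthonormal ℝ v)
    (s : Finset ι) {u : 𝒰} (hu : MemLp (fun w => k (w, u)) 2 p) :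
    ∑ i ∈ s, kernelIntegral p k (v i) u ^ 2 ≤ ∫ w, k (w, u) ^ 2 ∂p := by
  simpa only [inner_toLp_eq_kernelIntegral, norm_toLp_sq, Real.norm_eq_abs, sq_abs] using
    hv.sum_inner_products_le (s := s) (hu.toLp _)

variable [MeasurableSpace 𝒰] {q : Measure 𝒰}

lemma memLp_comp_swap [SFinite p] [SFinite q] (hk : MemLp k 2 (p.prod q)) :
    MemLp (k ∘ Prod.swap) 2 (q.prod p) :=
  hk.comp_measurePreserving Measure.measurePreserving_swap

lemma ae_memLp_slice [SFinite p] [SFinite q] (hk : MemLp k 2 (p.prod q)) :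
    ∀ᵐ u ∂q, MemLp (fun w => k (w, u)) 2 p := by
  filter_upwards [hk.integrable_sq.prod_left_ae, hk.1.prodMk_right] with u hu hmeas
  exact (memLp_two_iff_integrable_sq hmeas).mpr hu

lemma memLp_fst_mul_snd {g : 𝒲 → ℝ} {f : 𝒰 → ℝ} (hg : MemLp g 2 p) (hf : MemLp f 2 q) :
    MemLp (fun z : 𝒲 × 𝒰 => g z.1 * f z.2) 2 (p.prod q) := by
  refine (memLp_two_iff_integrable_sq (hg.1.comp_fst.mul hf.1.comp_snd)).mpr ?_
  simp only [Pi.mul_apply, mul_pow]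
  exact hg.integrable_sq.mul_prod hf.integrable_sq

variable [IsFiniteMeasure p] [IsFiniteMeasure q]

lemma coeFn_integralOperator (hk : MemLp k 2 (p.prod q)) (g : Lp ℝ 2 p) :
    integralOperator k hk g =ᵐ[q] kernelIntegral p k g :=
  (memLp_kernelIntegral hk (Lp.memLp g)).coeFn_toLp

lemma inner_integralOperator (hk : MemLp k 2 (p.prod q)) (f : Lp ℝ 2 q) (g : Lp ℝ 2 p) :
    inner ℝ f (integralOperator k hk g) = ∫ z, k z * (g z.1 * f z.2) ∂(p.prod q) := by
  have hint : Integrable (fun z : 𝒲 × 𝒰 => k z * (g z.1 * f z.2)) (p.prod q) :=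
    hk.integrable_mul (memLp_fst_mul_snd (Lp.memLp g) (Lp.memLp f))
  rw [integral_prod_symm _ hint, L2.inner_def]
  refine integral_congr_ae ((coeFn_integralOperator hk g).mono fun u hu => ?_)
  simp only [hu, Real.inner_apply, kernelIntegral, ← integral_const_mul]
  congr with w
  ring

lemma adjoint_integralOperator (hk : MemLp k 2 (p.prod q)) :
    (integralOperator k hk).adjoint = integralOperator (k ∘ Prod.swap) (memLp_comp_swap hk) := by
  refine ContinuousLinearMap.ext fun f => ext_inner_left ℝ fun g => ?_
  rw [ContinuousLinearMap.adjoint_inner_right, real_inner_comm, inner_integralOperator,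
    inner_integralOperator, ← integral_prod_swap]
  simp only [Function.comp_apply, Prod.fst_swap, Prod.snd_swap, mul_comm]

theorem isCompactOperator_integralOperator (hk : MemLp k 2 (p.prod q)) :
    IsCompactOperator (integralOperator k hk) := by
  obtain ⟨ι, b, -⟩ := exists_hilbertBasis ℝ (Lp ℝ 2 p)
  have hmem (i : ι) : MemLp (kernelIntegral p k (b i)) 2 q :=
    memLp_kernelIntegral hk (Lp.memLp (b i))
  refine isCompactOperator_of_summable_norm_sq b
    (summable_of_sum_le (c := ∫ u, ∫ w, k (w, u) ^ 2 ∂p ∂q) (fun _ => sq_nonneg _) fun s => ?_)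
  calc ∑ i ∈ s, ‖integralOperator k hk (b i)‖ ^ 2
      = ∑ i ∈ s, ∫ u, kernelIntegral p k (b i) u ^ 2 ∂q :=
        Finset.sum_congr rfl fun i _ => norm_toLp_sq (hmem i)
    _ = ∫ u, ∑ i ∈ s, kernelIntegral p k (b i) u ^ 2 ∂q :=
        (integral_finsetSum _ fun i _ => (hmem i).integrable_sq).symm
    _ ≤ ∫ u, ∫ w, k (w, u) ^ 2 ∂p ∂q :=
        integral_mono_ae (integrable_finsetSum _ fun i _ => (hmem i).integrable_sq)
          hk.integrable_sq.integral_prod_right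
          ((ae_memLp_slice hk).mono fun _ hu => sum_kernelIntegral_sq_le b.orthonormal s hu)

variable {ρ : Measure (𝒲 × 𝒰)} [SigmaFinite ρ]

lemma integralOperator_rnDeriv_eq_adjoint_comp (hρ : ρ ≪ p.prod q)
    (hfst : MeasurePreserving Prod.fst ρ p) (hsnd : MeasurePreserving Prod.snd ρ q)
    (hk : MemLp (fun z => (ρ.rnDeriv (p.prod q) z).toReal) 2 (p.prod q)) :
    integralOperator _ hk =
      (Lp.compMeasurePreservingₗᵢ ℝ Prod.snd hsnd).toContinuousLinearMap.adjoint ∘L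
        (Lp.compMeasurePreservingₗᵢ ℝ Prod.fst hfst).toContinuousLinearMap := by
  refine ContinuousLinearMap.ext fun g => ext_inner_left ℝ fun f => ?_
  rw [ContinuousLinearMap.comp_apply, ContinuousLinearMap.adjoint_inner_right,
    inner_integralOperator, integral_toReal_rnDeriv_mul hρ, L2.inner_def]
  refine integral_congr_ae ?_
  filter_upwards [Lp.coeFn_compMeasurePreserving g hfst, Lp.coeFn_compMeasurePreserving f hsnd]
    with z hg hf
  exact ((Real.inner_apply _ _).trans (by rw [mul_comm]; exact congrArg₂ _ hg hf)).symm

theorem norm_integralOperator_rnDeriv_le_one (hρ : ρ ≪ p.prod q)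
    (hfst : MeasurePreserving Prod.fst ρ p) (hsnd : MeasurePreserving Prod.snd ρ q)
    (hk : MemLp (fun z => (ρ.rnDeriv (p.prod q) z).toReal) 2 (p.prod q)) :
    ‖integralOperator _ hk‖ ≤ 1 := by
  rw [integralOperator_rnDeriv_eq_adjoint_comp hρ hfst hsnd hk]
  refine (ContinuousLinearMap.opNorm_comp_le _ _).trans
    (mul_le_one₀ ?_ (norm_nonneg _) (LinearIsometry.norm_toContinuousLinearMap_le _))
  exact (LinearIsometryEquiv.norm_map _ _).le.trans (LinearIsometry.norm_toContinuousLinearMap_le _)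

end KernelOperator

section ConditionalLaw

variable {Ω α β E : Type*} [MeasurableSpace Ω] [MeasurableSpace α] [MeasurableSpace β]
  [StandardBorelSpace β] [Nonempty β] [NormedAddCommGroup E] [NormedSpace ℝ E]
  [CompleteSpace E] {V : Ω → α} {Z : Ω → β}

theorem integral_condDistrib_ae_eq_integral_rnDeriv_smul {Q : Measure Ω} [IsFiniteMeasure Q]
    {ν : Measure β} [SigmaFinite ν] (hZ : Measurable Z)
    (hac : Q.map (fun ω => (V ω, Z ω)) ≪ (Q.map V).prod ν) {f : α × β → E}
    (hf : Integrable f (Q.map fun ω => (V ω, Z ω))) :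
    (fun v => ∫ z, f (v, z) ∂(condDistrib Z V Q v)) =ᵐ[Q.map V] fun v =>
      ∫ z, ((Q.map fun ω => (V ω, Z ω)).rnDeriv ((Q.map V).prod ν) (v, z)).toReal •
        f (v, z) ∂ν := by
  have hf' := (integrable_rnDeriv_smul_iff hac).mpr hf
  refine Integrable.ae_eq_of_forall_setIntegral_eq _ _
    (hf.integral_condDistrib_map hZ.aemeasurable) hf'.integral_prod_left fun s hs _ => ?_
  calc ∫ v in s, ∫ z, f (v, z) ∂(condDistrib Z V Q v) ∂(Q.map V)
      = ∫ x in s ×ˢ univ, f x ∂(Q.map fun ω => (V ω, Z ω)) := by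
        rw [← compProd_map_condDistrib hZ.aemeasurable] at hf ⊢
        rw [Measure.setIntegral_compProd hs .univ hf.integrableOn]
        simp only [Measure.restrict_univ]
    _ = ∫ x in s ×ˢ univ, ((Q.map fun ω => (V ω, Z ω)).rnDeriv ((Q.map V).prod ν) x).toReal •
          f x ∂((Q.map V).prod ν) := (setIntegral_rnDeriv_smul hac (hs.prod .univ)).symm
    _ = _ := by
        rw [setIntegral_prod _ hf'.integrableOn]
        simp only [Measure.restrict_univ]

lemma condKernel_map_ae_eq_condDistrib {γ : Type*} [MeasurableSpace γ]
    [MeasurableSpace.CountableOrCountablyGenerated γ α] (F : Kernel γ Ω) [IsFiniteKernel F]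
    (hV : Measurable V) (hZ : Measurable Z) (t : γ) :
    ∀ᵐ v ∂((F t).map V),
      (F.map fun ω => (V ω, Z ω)).condKernel (t, v) = condDistrib Z V (F t) v := by
  have h := Kernel.condKernel_apply_eq_condKernel (F.map fun ω => (V ω, Z ω)) t
  rw [Kernel.fst_map_prod _ hZ, Kernel.map_apply _ hV] at h
  simp only [condDistrib, ← Kernel.map_apply _ (hV.prodMk hZ)]
  exact h

end ConditionalLaw

section Fibre

variable {𝒲 𝒰 : Type*} [MeasurableSpace 𝒲] [MeasurableSpace 𝒰] {Q : Measure (ℝ × 𝒲 × 𝒰)}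

lemma map_fst_lawWU : (lawWU Q).map Prod.fst = lawW Q :=
  Measure.map_map measurable_fst measurable_snd

lemma map_snd_lawWU : (lawWU Q).map Prod.snd = lawU Q :=
  Measure.map_map measurable_snd measurable_snd

lemma map_swap_lawWU : (lawWU Q).map Prod.swap = Q.map fun z => (z.2.2, z.2.1) :=
  Measure.map_map measurable_swap measurable_snd

lemma integrable_comp_snd_lawWU {f : 𝒰 → ℝ} (hf : Integrable f (lawU Q)) :
    Integrable (fun z : 𝒲 × 𝒰 => f z.2) (lawWU Q) := by
  rw [← map_snd_lawWU] at hf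
  exact hf.comp_measurable measurable_snd

lemma integrable_comp_snd_map_swap {g : 𝒲 → ℝ} (hg : Integrable g (lawW Q)) :
    Integrable (fun z : 𝒰 × 𝒲 => g z.2) (Q.map fun z => (z.2.2, z.2.1)) := by
  rw [← map_fst_lawWU] at hg
  rw [← map_swap_lawWU]
  exact (integrable_map_equiv MeasurableEquiv.prodComm _).mpr (hg.comp_measurable measurable_fst)

variable [IsFiniteMeasure Q]

lemma integral_lawUGivenW_ae_eq [StandardBorelSpace 𝒰] [Nonempty 𝒰]
    (hac : lawWU Q ≪ (lawW Q).prod (lawU Q)) {f : 𝒰 → ℝ} (hf : Integrable f (lawU Q)) :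
    (fun w => ∫ u, f u ∂(lawUGivenW Q w)) =ᵐ[lawW Q]
      kernelIntegral (lawU Q) (densityRatio Q ∘ Prod.swap) f :=
  integral_condDistrib_ae_eq_integral_rnDeriv_smul (by fun_prop) hac
    (integrable_comp_snd_lawWU hf)

lemma densityRatio_comp_swap_ae_eq :
    densityRatio Q ∘ Prod.swap =ᵐ[(lawU Q).prod (lawW Q)] fun z =>
      ((Q.map fun z => (z.2.2, z.2.1)).rnDeriv ((lawU Q).prod (lawW Q)) z).toReal := by
  rw [← map_swap_lawWU, ← Measure.prod_swap]
  refine MeasurableEquiv.prodComm.measurableEmbedding.ae_map_iff.mpr ?_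
  filter_upwards [MeasurableEquiv.prodComm.measurableEmbedding.rnDeriv_map (lawWU Q)
    ((lawW Q).prod (lawU Q))] with z hz
  exact congrArg ENNReal.toReal hz.symm

lemma integral_lawWGivenU_ae_eq [StandardBorelSpace 𝒲] [Nonempty 𝒲]
    (hac : lawWU Q ≪ (lawW Q).prod (lawU Q)) {g : 𝒲 → ℝ} (hg : Integrable g (lawW Q)) :
    (fun u => ∫ w, g w ∂(lawWGivenU Q u)) =ᵐ[lawU Q]
      kernelIntegral (lawW Q) (densityRatio Q) g := by
  have hac' : Q.map (fun z => (z.2.2, z.2.1)) ≪ (lawU Q).prod (lawW Q) := by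
    rw [← map_swap_lawWU, ← Measure.prod_swap]
    exact hac.map measurable_swap
  filter_upwards [integral_condDistrib_ae_eq_integral_rnDeriv_smul (by fun_prop) hac'
    (integrable_comp_snd_map_swap hg), Measure.ae_ae_of_ae_prod densityRatio_comp_swap_ae_eq]
    with u hu hratio
  refine hu.trans (integral_congr_ae (hratio.mono fun w hw => ?_))
  exact congrArg (· * g w) hw.symm

namespace Regular

/-- The operator `K_{a,x}`, with kernel the density ratio `K(w, u, a, x)`. -/
noncomputable abbrev operator (hr : Regular Q) : Lp ℝ 2 (lawW Q) →L[ℝ] Lp ℝ 2 (lawU Q) :=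
  integralOperator (densityRatio Q) hr.ratio_memLp

/-- The function `E(Y | a, ·, x)` as an element of `L²{F(u | a, x)}`. -/
noncomputable abbrev outcome (hr : Regular Q) : Lp ℝ 2 (lawU Q) :=
  hr.outcome_memLp.toLp (outcomeMean Q)

lemma integral_lawWGivenU_ae_eq_operator [StandardBorelSpace 𝒲] [Nonempty 𝒲] (hr : Regular Q)
    {g : 𝒲 → ℝ} {v : Lp ℝ 2 (lawW Q)} (hg : g =ᵐ[lawW Q] v) :
    (fun u => ∫ w, g w ∂(lawWGivenU Q u)) =ᵐ[lawU Q] hr.operator v := by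
  refine (integral_lawWGivenU_ae_eq hr.abs_cont ?_).trans ?_
  · exact ((Lp.memLp v).integrable one_le_two).congr hg.symm
  · rw [kernelIntegral_congr_ae hg]
    exact (coeFn_integralOperator hr.ratio_memLp v).symm

lemma integral_lawUGivenW_ae_eq_adjoint_operator [StandardBorelSpace 𝒰] [Nonempty 𝒰]
    (hr : Regular Q) {f : 𝒰 → ℝ} {v : Lp ℝ 2 (lawU Q)} (hf : f =ᵐ[lawU Q] v) :
    (fun w => ∫ u, f u ∂(lawUGivenW Q w)) =ᵐ[lawW Q] hr.operator.adjoint v := by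
  refine (integral_lawUGivenW_ae_eq hr.abs_cont ?_).trans ?_
  · exact ((Lp.memLp v).integrable one_le_two).congr hf.symm
  · rw [kernelIntegral_congr_ae hf, adjoint_integralOperator]
    exact (coeFn_integralOperator (memLp_comp_swap hr.ratio_memLp) v).symm

lemma norm_operator_le_one (hr : Regular Q) : ‖hr.operator‖ ≤ 1 :=
  norm_integralOperator_rnDeriv_le_one hr.abs_cont ⟨measurable_fst, map_fst_lawWU⟩
    ⟨measurable_snd, map_snd_lawWU⟩ hr.ratio_memLp

lemma ker_adjoint_operator_eq_bot [StandardBorelSpace 𝒰] [Nonempty 𝒰] (hr : Regular Q)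
    (hc : Complete Q) : hr.operator.adjoint.ker = ⊥ := by
  refine (Submodule.eq_bot_iff _).mpr fun f hf => ?_
  refine Lp.eq_zero_iff_ae_eq_zero.mpr (hc f (Lp.memLp f) ?_)
  have hzero : hr.operator.adjoint f =ᵐ[lawW Q] 0 := Lp.eq_zero_iff_ae_eq_zero.mp hf
  exact (hr.integral_lawUGivenW_ae_eq_adjoint_operator EventuallyEq.rfl).trans hzero

theorem outcome_mem_range_operator [StandardBorelSpace 𝒲] [StandardBorelSpace 𝒰] [Nonempty 𝒰]
    (hr : Regular Q) (hc : Complete Q) : hr.outcome ∈ hr.operator.range := by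
  have : Fact ((2 : ℝ≥0∞) ≠ ∞) := ⟨ENNReal.ofNat_ne_top⟩
  obtain ⟨ι, _, ν, υ, κ, h⟩ :=
    exists_isSingularSystem (isCompactOperator_integralOperator hr.ratio_memLp)
  refine h.mem_range_of_summable ?_ (hr.picard ι ν υ κ h)
  rw [hr.ker_adjoint_operator_eq_bot hc, bot_orthogonal_eq_top]
  exact mem_top

end Regular

end Fibre

section TendstoInMeasure

variable {β E : Type*} [MeasurableSpace β] [PseudoEMetricSpace E] {μ : Measure β}
  {f : ℕ → β → E} {z : β → E}

lemma measure_add_le_edist_le {ε δ : ℝ≥0∞} (x y v : β → E) :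
    μ {b | ε + δ ≤ edist (x b) (y b)} ≤
      μ {b | ε ≤ edist (x b) (v b)} + μ {b | δ ≤ edist (v b) (y b)} := by
  refine (measure_mono fun b hb => ?_).trans (measure_union_le _ _)
  by_contra! h
  simp only [mem_union, Set.mem_ofPred_eq, not_or, not_le] at h
  exact (hb.trans (edist_triangle _ (v b) _)).not_gt (ENNReal.add_lt_add h.1 h.2)

lemma exists_forall_ge_measure_edist_le (hf : TendstoInMeasure μ f atTop z) {ε : ℝ≥0∞}
    (hε : 0 < ε) : ∃ n, ∀ m ≥ n, μ {b | ε ≤ edist (f n b) (f m b)} ≤ ε := by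
  have hhalf : 0 < ε / 2 := ENNReal.half_pos hε.ne'
  obtain ⟨n, hn⟩ := eventually_atTop.mp ((hf _ hhalf).eventually_le_const hhalf)
  refine ⟨n, fun m hm => ?_⟩
  calc μ {b | ε ≤ edist (f n b) (f m b)}
      = μ {b | ε / 2 + ε / 2 ≤ edist (f n b) (f m b)} := by rw [ENNReal.add_halves]
    _ ≤ μ {b | ε / 2 ≤ edist (f n b) (z b)} + μ {b | ε / 2 ≤ edist (z b) (f m b)} :=
        measure_add_le_edist_le _ _ _
    _ ≤ ε / 2 + ε / 2 := by
        simp only [edist_comm (z _)]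
        exact add_le_add (hn n le_rfl) (hn m hm)
    _ = ε := ENNReal.add_halves ε

lemma measure_add_self_le_edist_limit_le (hf : TendstoInMeasure μ f atTop z) {ε : ℝ≥0∞}
    (hε : 0 < ε) {n : ℕ} (hn : ∀ m ≥ n, μ {b | ε ≤ edist (f n b) (f m b)} ≤ ε) :
    μ {b | ε + ε ≤ edist (f n b) (z b)} ≤ ε := by
  have hlim := (hf ε hε).const_add ε
  rw [add_zero] at hlim
  refine ge_of_tendsto hlim ((eventually_ge_atTop n).mono fun m hm => ?_)
  exact (measure_add_le_edist_le _ _ (f m)).trans (add_le_add_left (hn m hm) _)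

lemma ae_tendsto_of_measure_le_edist_le {ε δ : ℕ → ℝ≥0∞} (hε : ∑' j, ε j ≠ ∞)
    (hδ : Tendsto δ atTop (𝓝 0)) (hf : ∀ j, μ {b | δ j ≤ edist (f j b) (z b)} ≤ ε j) :
    ∀ᵐ b ∂μ, Tendsto (fun j => f j b) atTop (𝓝 (z b)) := by
  filter_upwards [ae_eventually_notMem (ne_top_of_le_ne_top hε (ENNReal.tsum_le_tsum hf))]
    with b hb
  refine tendsto_iff_edist_tendsto_0.mpr ?_
  exact tendsto_of_tendsto_of_tendsto_of_le_of_le' tendsto_const_nhds hδ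
    (Eventually.of_forall fun _ => zero_le) (hb.mono fun _ hj => (not_le.mp hj).le)

lemma ae_tendsto_of_forall_ge_measure_edist_le (hf : TendstoInMeasure μ f atTop z)
    {ε : ℕ → ℝ≥0∞} (hpos : ∀ j, 0 < ε j) (hε : ∑' j, ε j ≠ ∞) {N : ℕ → ℕ}
    (hN : ∀ j, ∀ m ≥ N j, μ {b | ε j ≤ edist (f (N j) b) (f m b)} ≤ ε j) :
    ∀ᵐ b ∂μ, Tendsto (fun j => f (N j) b) atTop (𝓝 (z b)) := by
  have hzero : Tendsto (fun j => ε j + ε j) atTop (𝓝 0) := by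
    simpa only [add_zero] using (ENNReal.tendsto_atTop_zero_of_tsum_ne_top hε).add
      (ENNReal.tendsto_atTop_zero_of_tsum_ne_top hε)
  exact ae_tendsto_of_measure_le_edist_le hε hzero fun j =>
    measure_add_self_le_edist_limit_le hf (hpos j) (hN j)

end TendstoInMeasure

section FibrewiseLimit

variable {α β E : Type*} [MeasurableSpace α] [MeasurableSpace β]

lemma exists_measurable_nat_forall_of_exists {p : α → ℕ → Prop}
    (hp : ∀ n, MeasurableSet {a | p a n}) :
    ∃ N : α → ℕ, Measurable N ∧ ∀ a, (∃ n, p a n) → p a (N a) := by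
  classical
  have hex (a : α) : ∃ n, p a n ∨ ∀ k, ¬p a k := by
    by_cases h : ∃ n, p a n
    · exact h.imp fun _ => Or.inl
    · exact ⟨0, Or.inr (not_exists.mp h)⟩
  have hnone : MeasurableSet {a | ∀ k, ¬p a k} := by
    simp only [Set.ofPred_forall]
    exact MeasurableSet.iInter fun k => (hp k).compl
  exact ⟨fun a => Nat.find (hex a), measurable_find hex fun n => (hp n).union hnone,
    fun a ha => (Nat.find_spec (hex a)).resolve_right (not_forall_not.mpr ha)⟩

variable [PseudoEMetricSpace E] [SecondCountableTopology E] [MeasurableSpace E]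
  [OpensMeasurableSpace E]

lemma exists_measurable_nat_ae_tendsto_of_tendstoInMeasure (η : Kernel α β) [IsSFiniteKernel η]
    {g : ℕ → α × β → E} (hg : ∀ n, Measurable (g n)) :
    ∃ N : ℕ → α → ℕ, (∀ j, Measurable (N j)) ∧ ∀ a (z : β → E),
      TendstoInMeasure (η a) (fun n b => g n (a, b)) atTop z →
        ∀ᵐ b ∂(η a), Tendsto (fun j => g (N j a) (a, b)) atTop (𝓝 (z b)) := by
  obtain ⟨ε, hpos, hε⟩ := ENNReal.exists_pos_sum_of_countable' one_ne_zero ℕ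
  have hmeas (j n : ℕ) :
      MeasurableSet {a | ∀ m ≥ n, η a {b | ε j ≤ edist (g n (a, b)) (g m (a, b))} ≤ ε j} := by
    simp only [Set.ofPred_forall]
    refine MeasurableSet.iInter fun m => MeasurableSet.iInter fun _ => ?_
    have hset : MeasurableSet {x : α × β | ε j ≤ edist (g n x) (g m x)} :=
      measurableSet_le measurable_const ((hg n).edist (hg m))
    exact measurableSet_le (Kernel.measurable_kernel_prodMk_left hset) measurable_const
  choose N hN hspec using fun j => exists_measurable_nat_forall_of_exists (hmeas j)
  exact ⟨N, hN, fun a z hz => ae_tendsto_of_forall_ge_measure_edist_le hz hpos hε.ne_top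
    fun j => hspec j a (exists_forall_ge_measure_edist_le hz (hpos j))⟩

theorem exists_measurable_ae_eq_of_tendstoInMeasure {E : Type*} [MetricSpace E] [CompleteSpace E]
    [SecondCountableTopology E] [MeasurableSpace E] [BorelSpace E] [Nonempty E]
    (η : Kernel α β) [IsSFiniteKernel η] {g : ℕ → α × β → E} (hg : ∀ n, Measurable (g n)) :
    ∃ h : α × β → E, Measurable h ∧ ∀ a (z : β → E),
      TendstoInMeasure (η a) (fun n b => g n (a, b)) atTop z → (fun b => h (a, b)) =ᵐ[η a] z := by
  obtain ⟨N, hN, hlim⟩ := exists_measurable_nat_ae_tendsto_of_tendstoInMeasure η hg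
  have hgN (j : ℕ) : Measurable fun x : α × β => g (N j x.1) x :=
    (measurable_from_prod_countable_right hg : Measurable fun y : ℕ × (α × β) => g y.1 y.2).comp
      (((hN j).comp measurable_fst).prodMk measurable_id)
  refine ⟨fun x => limUnder atTop fun j => g (N j x.1) x,
    (StronglyMeasurable.limUnder fun j => (hgN j).stronglyMeasurable).measurable, fun a z hz => ?_⟩
  exact (hlim a z hz).mono fun b hb => hb.limUnder_eq

end FibrewiseLimit

section Landweber

variable {α 𝒲 𝒰 : Type*} [MeasurableSpace α] [MeasurableSpace 𝒲] [MeasurableSpace 𝒰]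
  {κ : Kernel (α × 𝒰) 𝒲} {η : Kernel (α × 𝒲) 𝒰} {m : α × 𝒰 → ℝ}

/-- The Landweber iterates for the equations `m(t, u) = ∫ g(t, w) κ(dw | t, u)`, started at zero,
with the kernel `η` in the role of the adjoint of `κ`. -/
noncomputable def landweber (κ : Kernel (α × 𝒰) 𝒲) (η : Kernel (α × 𝒲) 𝒰) (m : α × 𝒰 → ℝ) :
    ℕ → α × 𝒲 → ℝ
  | 0 => 0
  | n + 1 => fun x => landweber κ η m n x +
      ∫ u, (m (x.1, u) - ∫ w, landweber κ η m n (x.1, w) ∂(κ (x.1, u))) ∂(η x)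

lemma stronglyMeasurable_landweber [IsSFiniteKernel κ] [IsSFiniteKernel η]
    (hm : StronglyMeasurable m) (n : ℕ) : StronglyMeasurable (landweber κ η m n) := by
  induction n with
  | zero => exact stronglyMeasurable_zero
  | succ n ih =>
    have hκ : StronglyMeasurable fun x : α × 𝒰 => ∫ w, landweber κ η m n (x.1, w) ∂(κ x) :=
      StronglyMeasurable.integral_kernel_prod_right'
        (f := fun y : (α × 𝒰) × 𝒲 => landweber κ η m n (y.1.1, y.2))
        (ih.comp_measurable (by fun_prop))
    exact ih.add (StronglyMeasurable.integral_kernel_prod_right'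
      (f := fun y : (α × 𝒲) × 𝒰 => m (y.1.1, y.2) -
        ∫ w, landweber κ η m n (y.1.1, w) ∂(κ (y.1.1, y.2)))
      ((hm.sub hκ).comp_measurable
        (g := fun y : (α × 𝒲) × 𝒰 => (y.1.1, y.2)) (by fun_prop)))

variable [StandardBorelSpace 𝒲] [Nonempty 𝒲] [StandardBorelSpace 𝒰] [Nonempty 𝒰]
  {Q : Measure (ℝ × 𝒲 × 𝒰)} [IsFiniteMeasure Q] {t : α}

lemma landweber_ae_eq_iterate (hr : Regular Q)
    (hκ : ∀ᵐ u ∂(lawU Q), κ (t, u) = lawWGivenU Q u)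
    (hη : ∀ᵐ w ∂(lawW Q), η (t, w) = lawUGivenW Q w)
    (hm : ∀ᵐ u ∂(lawU Q), m (t, u) = outcomeMean Q u) (n : ℕ) :
    (fun w => landweber κ η m n (t, w)) =ᵐ[lawW Q]
      ((fun v => v + hr.operator.adjoint (hr.outcome - hr.operator v))^[n] 0 :
        Lp ℝ 2 (lawW Q)) := by
  induction n with
  | zero => exact (Lp.coeFn_zero ..).symm
  | succ n ih =>
    rw [Function.iterate_succ_apply']
    set v := (fun v => v + hr.operator.adjoint (hr.outcome - hr.operator v))^[n]
      (0 : Lp ℝ 2 (lawW Q))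
    have hres : (fun u => m (t, u) - ∫ w, landweber κ η m n (t, w) ∂(κ (t, u))) =ᵐ[lawU Q]
        (hr.outcome - hr.operator v : Lp ℝ 2 (lawU Q)) := by
      filter_upwards [hκ, hm, hr.outcome_memLp.coeFn_toLp,
        hr.integral_lawWGivenU_ae_eq_operator ih,
        Lp.coeFn_sub hr.outcome (hr.operator v)] with u hκu hmu hout hop hsub
      rw [hsub, Pi.sub_apply, hout, ← hop, hκu, hmu]
    filter_upwards [ih, hη, hr.integral_lawUGivenW_ae_eq_adjoint_operator hres,
      Lp.coeFn_add v (hr.operator.adjoint (hr.outcome - hr.operator v))] with w hw hηw hadj hadd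
    rw [hadd, Pi.add_apply, ← hw, ← hadj, ← hηw, landweber]

theorem exists_tendstoInMeasure_average_landweber (hc : Complete Q) (hr : Regular Q)
    (hκ : ∀ᵐ u ∂(lawU Q), κ (t, u) = lawWGivenU Q u)
    (hη : ∀ᵐ w ∂(lawW Q), η (t, w) = lawUGivenW Q w)
    (hm : ∀ᵐ u ∂(lawU Q), m (t, u) = outcomeMean Q u) :
    ∃ z : Lp ℝ 2 (lawW Q), hr.operator z = hr.outcome ∧
      TendstoInMeasure (lawW Q)
        (fun (N : ℕ) w => (N : ℝ)⁻¹ * ∑ n ∈ Finset.range N, landweber κ η m n (t, w)) atTop z := by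
  let x (n : ℕ) : Lp ℝ 2 (lawW Q) :=
    (fun v => v + hr.operator.adjoint (hr.outcome - hr.operator v))^[n] 0
  obtain ⟨z, hz, hlim⟩ := exists_tendsto_average_landweber hr.norm_operator_le_one
    (hr.outcome_mem_range_operator hc) (x := x) fun n => Function.iterate_succ_apply' _ n _
  refine ⟨z, hz, (tendstoInMeasure_of_tendsto_Lp hlim).congr_left fun N => ?_⟩
  have hx : ∀ᵐ w ∂(lawW Q), ∀ n, landweber κ η m n (t, w) = x n w :=
    ae_all_iff.mpr (landweber_ae_eq_iterate hr hκ hη hm)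
  filter_upwards [hx, Lp.coeFn_smul (N : ℝ)⁻¹ (∑ n ∈ Finset.range N, x n),
    Lp.coeFn_finsetSum (Finset.range N) x] with w hxw hsmul hsum
  simp only [hsmul, Pi.smul_apply, hsum, Finset.sum_apply, smul_eq_mul, hxw]

end Landweber

lemma solvesBridgeEquation_of_operator_eq {𝒲 𝒰 : Type*} [MeasurableSpace 𝒲]
    [StandardBorelSpace 𝒲] [Nonempty 𝒲] [MeasurableSpace 𝒰] {Q : Measure (ℝ × 𝒲 × 𝒰)}
    [IsFiniteMeasure Q] (hr : Regular Q) {z : Lp ℝ 2 (lawW Q)}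
    (hz : hr.operator z = hr.outcome) {g : 𝒲 → ℝ} (hg : g =ᵐ[lawW Q] z) :
    SolvesBridgeEquation Q g where
  memLp := (memLp_congr_ae hg).mpr (Lp.memLp z)
  integrable := (integrable_comp_snd_map_swap (((Lp.memLp z).integrable one_le_two).congr
    hg.symm)).condDistrib_ae_map (by fun_prop)
  equation := by
    filter_upwards [hr.integral_lawWGivenU_ae_eq_operator hg, hr.outcome_memLp.coeFn_toLp]
      with u hu hout
    rw [hu, hz, hout]

end ConfoundingBridge

open ConfoundingBridge in
theorem lemma1_general {α 𝒲 𝒰 : Type*} [MeasurableSpace α]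
    [MeasurableSpace 𝒲] [StandardBorelSpace 𝒲] [Nonempty 𝒲]
    [MeasurableSpace 𝒰] [StandardBorelSpace 𝒰] [Nonempty 𝒰]
    (F : Kernel α (ℝ × 𝒲 × 𝒰)) [IsFiniteKernel F] :
    ∃ h : α × 𝒲 → ℝ, Measurable h ∧ ∀ t, Complete (F t) → Regular (F t) →
      SolvesBridgeEquation (F t) (fun w => h (t, w)) := by
  have hW : Measurable fun z : ℝ × 𝒲 × 𝒰 => z.2.1 := by fun_prop
  have hU : Measurable fun z : ℝ × 𝒲 × 𝒰 => z.2.2 := by fun_prop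
  let κ : Kernel (α × 𝒰) 𝒲 := (F.map fun z => (z.2.2, z.2.1)).condKernel
  let η : Kernel (α × 𝒲) 𝒰 := (F.map fun z => (z.2.1, z.2.2)).condKernel
  let ρ : Kernel (α × 𝒰) ℝ := (F.map fun z => (z.2.2, z.1)).condKernel
  let m : α × 𝒰 → ℝ := fun x => ∫ y, y ∂(ρ x)
  have hm : StronglyMeasurable m := stronglyMeasurable_id.integral_kernel
  have havg (N : ℕ) : Measurable fun x : α × 𝒲 =>
      (N : ℝ)⁻¹ * ∑ n ∈ Finset.range N, landweber κ η m n x :=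
    (Finset.measurable_fun_sum _ fun n _ =>
      (stronglyMeasurable_landweber hm n).measurable).const_mul _
  obtain ⟨h, hh, hlim⟩ := exists_measurable_ae_eq_of_tendstoInMeasure (F.map fun z => z.2.1) havg
  refine ⟨h, hh, fun t hc hr => ?_⟩
  have hmean : ∀ᵐ u ∂(lawU (F t)), m (t, u) = outcomeMean (F t) u :=
    (condKernel_map_ae_eq_condDistrib F hU measurable_fst t).mono fun u hu =>
      congrArg (fun ν : Measure ℝ => ∫ y, y ∂ν) hu
  obtain ⟨z, hz, hconv⟩ := exists_tendstoInMeasure_average_landweber hc hr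
    (condKernel_map_ae_eq_condDistrib F hU hW t) (condKernel_map_ae_eq_condDistrib F hW hU t) hmean
  have hlimit := hlim t z
  rw [Kernel.map_apply F hW] at hlimit
  exact solvesBridgeEquation_of_operator_eq hr hz (hlimit hconv)

theorem lemma1 {Ω 𝒜 𝒳 𝒲 𝒰 : Type*} [MeasurableSpace Ω] [MeasurableSpace 𝒜] [MeasurableSpace 𝒳]
    [MeasurableSpace 𝒲] [StandardBorelSpace 𝒲] [Nonempty 𝒲]
    [MeasurableSpace 𝒰] [StandardBorelSpace 𝒰] [Nonempty 𝒰]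
    (P : Measure Ω) [IsProbabilityMeasure P]
    (Y : Ω → ℝ) (A : Ω → 𝒜) (X : Ω → 𝒳) (W : Ω → 𝒲) (U : Ω → 𝒰) (S : Ω → Fin 2)
    (hY : Measurable Y) (hA : Measurable A) (hX : Measurable X) (hW : Measurable W)
    (hU : Measurable U) (hS : Measurable S) (hS1 : P {ω | S ω = 1} ≠ 0)
    -- a version of the conditional law of `(Y, W, U)` given `A, X` and `S = 1`
    (F : Kernel (𝒜 × 𝒳) (ℝ × 𝒲 × 𝒰)) [IsMarkovKernel F]
    (hF : HasCondDistrib (fun ω => (Y ω, W ω, U ω)) (fun ω => (A ω, X ω)) F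
      (P[|{ω | S ω = 1}]))
    -- the values `(a, x)` under consideration, such as the support of `(A, X)`
    (T : Set (𝒜 × 𝒳))
    (hcomplete : ∀ t ∈ T, ConfoundingBridge.Complete (F t))
    (hregular : ∀ t ∈ T, ConfoundingBridge.Regular (F t)) :
    ∃ h : 𝒲 → 𝒜 → 𝒳 → ℝ, Measurable (fun z : 𝒲 × 𝒜 × 𝒳 => h z.1 z.2.1 z.2.2) ∧
      ∀ a x, (a, x) ∈ T →
        ConfoundingBridge.SolvesBridgeEquation (F (a, x)) (fun w => h w a x) := by
  obtain ⟨h, hmeas, hsolves⟩ := lemma1_general F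
  exact ⟨fun w a x => h ((a, x), w), hmeas.comp (by fun_prop),
    fun a x hax => hsolves (a, x) (hcomplete _ hax) (hregular _ hax)⟩
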